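/- Let $(\rho_n)$ be the zeros of the Riemann zeta function with $\operatorname{Im}\rho_n>0$, each repeated according to its multiplicity, and write $\rho_n=\tfrac12+i\alpha_n$ (the Riemann hypothesis is not assumed, so the $\alpha_n$ may be non-real; $\operatorname{Re}\alpha_n>0$). Put $$Z(s)=\sum_{n}\frac1{\alpha_n^{s}}\quad(\operatorname{Re}s>1),\qquad f(z)=\sum_{n}e^{-\alpha_n^2z}\quad(\operatorname{Re}z>0),$$ where $\alpha_n^s$ is the principal power. Then the series defining $f$ converges absolutely for every $z$ with $\operatorname{Re}z>0$, and $f$ is holomorphic on the half-plane $\operatorname{Re}z>0$. Moreover, for every complex $s$ with $\operatorname{Re}s>1$, the series defining $Z(s)$ converges absolutely, the function $x\mapsto f(x)x^{s/2-1}$ is Lebesgue integrable on $(0,\infty)$, and $$\Gamma(s/2)\,Z(s)=\int_0^{\infty}f(x)\,x^{s/2}\,\frac{dx}{x}=\int_0^\infty f(x)\,x^{s/2-1}\,dx.$$ (Both series converge absolutely, so the order in which the zeros are arranged is immaterial.) -/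

import Mathlib

/-- The zeros `ρ` of the Riemann zeta function with `0 < Im ρ`. -/
def UpperZetaZero : Type := {ρ : ℂ // riemannZeta ρ = 0 ∧ 0 < ρ.im}

/-- Index type for the zeros of the Riemann zeta function with positive imaginary part, each zero
being repeated according to its order of multiplicity: an index is a zero `ρ` together with an
element of `Fin m`, where `m` is the order of vanishing of `riemannZeta` at `ρ`. -/
def ZetaZeroIndex : Type := Σ ρ : UpperZetaZero, Fin (analyticOrderNatAt riemannZeta ρ.val)

/-- The zero `ρ_n` belonging to the index `n`. -/
def zetaZero (n : ZetaZeroIndex) : ℂ := n.1.val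

/-- The number `α_n` determined by `ρ_n = 1/2 + i α_n`. -/
noncomputable def zetaAlpha (n : ZetaZeroIndex) : ℂ := (zetaZero n - 1 / 2) / Complex.I

theorem zetaZero_eq (n : ZetaZeroIndex) : zetaZero n = 1 / 2 + Complex.I * zetaAlpha n := by
  rw [zetaAlpha, mul_div_cancel₀ _ Complex.I_ne_zero]
  ring

/-- The secondary zeta function `Z(s) = ∑ α_n ^ (-s)` (principal powers), for `1 < Re s`. -/
noncomputable def secondaryZeta (s : ℂ) : ℂ := ∑' n : ZetaZeroIndex, 1 / zetaAlpha n ^ s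

/-- The function `f(z) = ∑ exp (-α_n² z)`, for `0 < Re z`. -/
noncomputable def zeroTheta (z : ℂ) : ℂ :=
  ∑' n : ZetaZeroIndex, Complex.exp (-(zetaAlpha n) ^ 2 * z)

/-! Termwise, `Γ(s/2) α^(-s) = ∫ exp(-α²x) x^(s/2-1) dx`, so the theorem rests on two facts about
the zeros: `Re α²` is positive and at least a multiple of `|α|²`, and `∑ |α|^(-σ)` converges for `σ
> 1`. Both follow from one estimate. `Λ₀` is a Mellin transform of a nonnegative kernel, so in a
vertical strip its modulus is at most the sum of its moduli at the real points of the two edges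
(`norm_completedRiemannZeta₀_le`). In the critical strip this excludes zeros with `0 < Im ρ ≤ 1`,
whence `Re α > 1`, while `|Im α| < 1/2`. On large discs it bounds `entireZeta`, and a Jensen-type
inequality gives `O(N log N)` zeros of modulus at most `N` (`card_zetaZero_le`). Absolute
convergence then justifies exchanging sum and integral; the gamma integral at complex `α²` comes
from the identity theorem. -/

/-! ### Bounds for `Λ₀` in vertical strips -/

-- The kernel is nonnegative: the theta series has constant term 1, so it exceeds the term
-- subtracted for `x > 1`, and the functional equation carries this to `x < 1`.
open Complex in
theorem ofReal_norm_f_modif_hurwitzEvenFEPair_zero (x : ℝ) :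
    ((‖(HurwitzZeta.hurwitzEvenFEPair 0).f_modif x‖ : ℝ) : ℂ) =
      (HurwitzZeta.hurwitzEvenFEPair 0).f_modif x := by
  have hk : ∀ t : ℝ, 0 < t → 1 ≤ HurwitzZeta.evenKernel 0 t := by
    intro t ht
    have h := HurwitzZeta.hasSum_int_evenKernel 0 ht
    have h2 := le_hasSum h 0 (fun n _ => (Real.exp_pos _).le)
    simpa using h2
  suffices h : ∃ y : ℝ, 0 ≤ y ∧ (HurwitzZeta.hurwitzEvenFEPair 0).f_modif x = y by
    obtain ⟨y, hy, h⟩ := h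
    rw [h, norm_real, Real.norm_of_nonneg hy]
  rw [WeakFEPair.f_modif, Pi.add_apply]
  rcases lt_trichotomy x 1 with hx | rfl | hx
  · rw [Set.indicator_of_notMem (by simpa using hx.le), zero_add]
    by_cases h0 : 0 < x
    · rw [Set.indicator_of_mem (show x ∈ Set.Ioo 0 1 from ⟨h0, hx⟩)]
      refine ⟨HurwitzZeta.evenKernel 0 x - x ^ (-(1 / 2) : ℝ), ?_, ?_⟩
      · rw [HurwitzZeta.evenKernel_functional_equation,
          ← HurwitzZeta.evenKernel_eq_cosKernel_of_zero, Real.rpow_neg h0.le, one_div (x ^ _),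
          sub_nonneg]
        exact le_mul_of_one_le_right (by positivity) (hk _ (by positivity))
      · simp [HurwitzZeta.hurwitzEvenFEPair]
    · rw [Set.indicator_of_notMem (fun h => h0 h.1)]
      exact ⟨0, le_rfl, by simp⟩
  -- Both indicators omit the point 1, so the modified kernel vanishes there.
  · exact ⟨0, le_rfl, by simp⟩
  · rw [Set.indicator_of_mem (by simpa using hx),
      Set.indicator_of_notMem (by simp [hx.le]), add_zero]
    refine ⟨HurwitzZeta.evenKernel 0 x - 1, sub_nonneg.2 (hk x (by linarith)), ?_⟩
    simp [HurwitzZeta.hurwitzEvenFEPair]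

open Complex MeasureTheory in
theorem norm_mellin_le_integral {f : ℝ → ℂ} (s : ℂ) :
    ‖mellin f s‖ ≤ ∫ x in Set.Ioi (0 : ℝ), x ^ (s.re - 1) * ‖f x‖ := by
  refine (norm_integral_le_integral_norm _).trans_eq
    (setIntegral_congr_fun measurableSet_Ioi fun x hx => ?_)
  simp [norm_cpow_eq_rpow_re_of_pos hx]

open Complex MeasureTheory in
theorem integrableOn_rpow_mul_norm_of_mellinConvergent {f : ℝ → ℂ} {σ : ℝ}
    (h : MellinConvergent f σ) :
    IntegrableOn (fun x : ℝ => x ^ (σ - 1) * ‖f x‖) (Set.Ioi 0) := by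
  refine (integrableOn_congr_fun (fun x hx => ?_) measurableSet_Ioi).1 h.norm
  simp [norm_cpow_eq_rpow_re_of_pos hx]

-- The kernel being nonnegative, its Mellin transform at a real point is the integral of its norm;
-- and `x ^ σ` is dominated by the left-edge power for `x ≤ 1`, by the right-edge power for `x ≥ 1`.
open Complex MeasureTheory in
theorem norm_completedRiemannZeta₀_le {s : ℂ} {a b : ℝ} (ha : a ≤ s.re) (hb : s.re ≤ b) :
    ‖completedRiemannZeta₀ s‖ ≤ ‖completedRiemannZeta₀ a‖ + ‖completedRiemannZeta₀ b‖ := by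
  set P := HurwitzZeta.hurwitzEvenFEPair 0 with hP
  have hconv : ∀ s, MellinConvergent P.f_modif s := fun s =>
    (P.isStrongFEPair_toStrongFEPair.hasMellin s).1
  have hint : ∀ σ : ℝ, IntegrableOn (fun x : ℝ => x ^ (σ - 1) * ‖P.f_modif x‖) (Set.Ioi 0) :=
    fun σ => integrableOn_rpow_mul_norm_of_mellinConvergent (hconv σ)
  have hreal : ∀ σ : ℝ, (mellin P.f_modif (σ : ℂ)) =
      ((∫ x in Set.Ioi (0 : ℝ), x ^ (σ - 1) * ‖P.f_modif x‖ : ℝ) : ℂ) := by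
    intro σ
    rw [mellin, ← integral_complex_ofReal]
    refine setIntegral_congr_fun measurableSet_Ioi fun x (hx : 0 < x) => ?_
    rw [ofReal_mul, hP, ofReal_norm_f_modif_hurwitzEvenFEPair_zero, ofReal_cpow hx.le, smul_eq_mul]
    simp
  have hnn : ∀ σ : ℝ, 0 ≤ ∫ x in Set.Ioi (0 : ℝ), x ^ (σ - 1) * ‖P.f_modif x‖ := fun σ =>
    setIntegral_nonneg measurableSet_Ioi fun x (hx : 0 < x) => by positivity
  have heq : ∀ s, completedRiemannZeta₀ s = mellin P.f_modif (s / 2) / 2 := fun s => rfl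
  have hσ : ∀ σ : ℝ, ‖completedRiemannZeta₀ σ‖ =
      (∫ x in Set.Ioi (0 : ℝ), x ^ (σ / 2 - 1) * ‖P.f_modif x‖) / 2 := by
    intro σ
    have : ((σ : ℂ) / 2) = ((σ / 2 : ℝ) : ℂ) := by push_cast; rfl
    rw [heq, this, hreal, norm_div, norm_real, Real.norm_of_nonneg (hnn _)]
    simp
  rw [hσ, hσ, heq, norm_div, ← add_div]
  have h2 : ‖(2 : ℂ)‖ = 2 := by simp
  rw [h2]
  gcongr
  refine (norm_mellin_le_integral _).trans ?_
  rw [← integral_add (hint _) (hint _)]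
  refine setIntegral_mono_on ?_ ((hint _).add (hint _)) measurableSet_Ioi fun x (hx : 0 < x) => ?_
  · exact hint (s / 2).re
  · rw [← add_mul]
    gcongr
    have hre : (s / 2).re = s.re / 2 := by simp
    rw [hre]
    rcases le_total x 1 with h | h
    · have := Real.rpow_le_rpow_of_exponent_ge hx h (show a / 2 - 1 ≤ s.re / 2 - 1 by linarith)
      have := Real.rpow_nonneg hx.le (b / 2 - 1)
      linarith
    · have := Real.rpow_le_rpow_of_exponent_le h (show s.re / 2 - 1 ≤ b / 2 - 1 by linarith)
      have := Real.rpow_nonneg hx.le (a / 2 - 1)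
      linarith

theorem norm_completedRiemannZeta₀_one_lt : ‖completedRiemannZeta₀ 1‖ < 1 / 3 := by
  have h : completedRiemannZeta₀ 1 =
      (((Real.eulerMascheroniConstant - Real.log (4 * Real.pi)) / 2 + 1 : ℝ) : ℂ) := by
    rw [completedRiemannZeta₀_one, Complex.ofReal_add, Complex.ofReal_div, Complex.ofReal_sub,
      Complex.ofReal_log (by positivity)]
    push_cast
    rfl
  have h1 := Real.eulerMascheroniConstant_lt_two_thirds
  have h2 := Real.one_half_lt_eulerMascheroniConstant
  -- With `γ < 2/3` this gives exactly the upper bound 1/3; the lower bound has room to spare.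
  have h3 : (2 : ℝ) < Real.log (4 * Real.pi) := by
    rw [Real.lt_log_iff_exp_lt (by positivity)]
    have := Real.exp_one_lt_d9
    have h4 : Real.exp 2 = Real.exp 1 * Real.exp 1 := by rw [← Real.exp_add]; norm_num
    have := Real.pi_gt_three
    have := Real.exp_pos 1
    rw [h4]
    nlinarith
  have h5 : Real.log (4 * Real.pi) < 2.79 := by
    rw [Real.log_lt_iff_lt_exp (by positivity)]
    have := Real.exp_one_gt_d9
    have h4 : Real.exp 2.79 = Real.exp 1 * Real.exp 1 * Real.exp 0.79 := by
      rw [← Real.exp_add, ← Real.exp_add]; norm_num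
    have h6 : (0.79 : ℝ) + 1 ≤ Real.exp 0.79 := Real.add_one_le_exp _
    have := Real.pi_lt_d2
    rw [h4]
    have : (7.38 : ℝ) < Real.exp 1 * Real.exp 1 := by nlinarith
    nlinarith
  rw [h, Complex.norm_real, Real.norm_eq_abs, abs_lt]
  constructor <;> norm_num at * <;> linarith

theorem completedRiemannZeta₀_zero_eq_one :
    completedRiemannZeta₀ 0 = completedRiemannZeta₀ 1 := by
  rw [← completedRiemannZeta₀_one_sub]; simp

/-! ### Location of the zeros -/

theorem ne_zero_and_ne_one_of_im_pos {s : ℂ} (h : 0 < s.im) : s ≠ 0 ∧ s ≠ 1 :=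
  ⟨by rintro rfl; simp at h, by rintro rfl; simp at h⟩

theorem Complex.Gammaℝ_ne_zero_of_im_pos {s : ℂ} (h : 0 < s.im) : Complex.Gammaℝ s ≠ 0 := by
  rw [Ne, Complex.Gammaℝ_eq_zero_iff]
  rintro ⟨n, rfl⟩
  simp at h

theorem completedRiemannZeta_eq_zero_of_riemannZeta {s : ℂ} (hs : riemannZeta s = 0)
    (him : 0 < s.im) : completedRiemannZeta s = 0 := by
  rw [riemannZeta_def_of_ne_zero (ne_zero_and_ne_one_of_im_pos him).1, div_eq_zero_iff] at hs
  exact hs.resolve_right (Complex.Gammaℝ_ne_zero_of_im_pos him)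

theorem re_mem_Ioo_of_riemannZeta_eq_zero {s : ℂ} (hs : riemannZeta s = 0) (him : 0 < s.im) :
    s.re ∈ Set.Ioo 0 1 := by
  constructor
  · by_contra h
    have h1 : completedRiemannZeta (1 - s) = 0 := by
      rw [completedRiemannZeta_one_sub, completedRiemannZeta_eq_zero_of_riemannZeta hs him]
    have hne : (1 - s) ≠ 0 := by
      rw [sub_ne_zero]; exact (ne_zero_and_ne_one_of_im_pos him).2.symm
    refine riemannZeta_ne_zero_of_one_le_re (s := 1 - s) (by simp; linarith) ?_
    rw [riemannZeta_def_of_ne_zero hne, h1, zero_div]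
  · by_contra! h
    exact riemannZeta_ne_zero_of_one_le_re h hs

/-- A zero satisfies `s (1 - s) Λ₀(s) = 1`, but at height at most 1 the factors are bounded by 3/2
and strictly by 2/3. -/
theorem one_lt_im_of_riemannZeta_eq_zero {s : ℂ} (hs : riemannZeta s = 0) (him : 0 < s.im) :
    1 < s.im := by
  by_contra! h
  obtain ⟨h0, h1⟩ := re_mem_Ioo_of_riemannZeta_eq_zero hs him
  obtain ⟨hs0, hs1⟩ := ne_zero_and_ne_one_of_im_pos him
  have hΛ := completedRiemannZeta_eq_zero_of_riemannZeta hs him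
  have hs1' : 1 - s ≠ 0 := sub_ne_zero.2 hs1.symm
  have heq : s * (1 - s) * completedRiemannZeta₀ s = 1 := by
    rw [completedRiemannZeta_eq] at hΛ
    field_simp at hΛ
    linear_combination hΛ
  have hb := norm_completedRiemannZeta₀_le (a := 0) (b := 1) h0.le h1.le
  rw [Complex.ofReal_zero, Complex.ofReal_one, completedRiemannZeta₀_zero_eq_one] at hb
  have hone := norm_completedRiemannZeta₀_one_lt
  have hn : ‖s‖ * ‖1 - s‖ * ‖completedRiemannZeta₀ s‖ = 1 := by
    rw [← norm_mul, ← norm_mul, heq, norm_one]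
  have hs2 : ‖s‖ ^ 2 = s.re ^ 2 + s.im ^ 2 := by rw [Complex.sq_norm, Complex.normSq_apply]; ring
  have hs3 : ‖1 - s‖ ^ 2 = (1 - s.re) ^ 2 + s.im ^ 2 := by
    rw [Complex.sq_norm, Complex.normSq_apply]; simp; ring
  -- AM-GM: the two squares add up to at most `1 + 2 = 3`.
  have hprod : ‖s‖ * ‖1 - s‖ ≤ 3 / 2 := by
    nlinarith [sq_nonneg (‖s‖ - ‖1 - s‖)]
  have hlt : ‖completedRiemannZeta₀ s‖ < 2 / 3 := by linarith
  have := norm_nonneg (completedRiemannZeta₀ s)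
  nlinarith [mul_le_mul_of_nonneg_right hprod this]

/-! ### Counting the zeros -/

/-- The entire function `s (1 - s) Λ(s)`, where `Λ` is the completed Riemann zeta function. -/
noncomputable def entireZeta (s : ℂ) : ℂ := s * (1 - s) * completedRiemannZeta₀ s - 1

theorem differentiable_entireZeta : Differentiable ℂ entireZeta := by
  have := differentiable_completedZeta₀
  unfold entireZeta
  fun_prop

theorem entireZeta_eq {s : ℂ} (h0 : s ≠ 0) (h1 : s ≠ 1) :
    entireZeta s = s * (1 - s) * completedRiemannZeta s := by
  have : 1 - s ≠ 0 := sub_ne_zero.2 h1.symm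
  rw [entireZeta, completedRiemannZeta_eq]
  field_simp
  ring

theorem analyticOrderAt_entireZeta {s : ℂ} (him : 0 < s.im) :
    analyticOrderAt entireZeta s = analyticOrderAt riemannZeta s := by
  have hU : IsOpen {z : ℂ | 0 < z.im} := isOpen_lt continuous_const Complex.continuous_im
  have hsU : {z : ℂ | 0 < z.im} ∈ nhds s := hU.mem_nhds him
  have hG : AnalyticAt ℂ (fun z : ℂ => (Complex.Gammaℝ z)⁻¹) s :=
    Complex.differentiable_Gammaℝ_inv.analyticAt s
  have hΓ : Complex.Gammaℝ s ≠ 0 := Complex.Gammaℝ_ne_zero_of_im_pos him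
  obtain ⟨hs0, hs1⟩ := ne_zero_and_ne_one_of_im_pos him
  have hp : AnalyticAt ℂ (fun z : ℂ => z * (1 - z)) s := by fun_prop
  have hζ : AnalyticAt ℂ riemannZeta s := analyticOn_riemannZeta s hs1
  have hF : AnalyticAt ℂ entireZeta s := differentiable_entireZeta.analyticAt s
  -- Using the entire function `1/Γℝ` makes every factor analytic; the two auxiliary factors have
  -- order 0 here.
  have key : (fun z => (Complex.Gammaℝ z)⁻¹) * entireZeta =ᶠ[nhds s]
      (fun z : ℂ => z * (1 - z)) * riemannZeta := by
    filter_upwards [hsU] with z hz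
    obtain ⟨h0, h1⟩ := ne_zero_and_ne_one_of_im_pos hz
    simp only [Pi.mul_apply]
    rw [entireZeta_eq h0 h1, riemannZeta_def_of_ne_zero h0]
    ring
  have h := analyticOrderAt_congr key
  rw [analyticOrderAt_mul hG hF, analyticOrderAt_mul hp hζ,
    hG.analyticOrderAt_eq_zero.2 (inv_ne_zero hΓ),
    hp.analyticOrderAt_eq_zero.2 (mul_ne_zero hs0 (sub_ne_zero.2 hs1.symm))] at h
  simpa using h

theorem card_le_sum_divisor_entireZeta {r : ℝ} (s : Finset ZetaZeroIndex)
    (hs : ∀ i ∈ s, ‖zetaZero i‖ ≤ r) :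
    (s.card : ℤ) ≤ ∑ᶠ u, MeromorphicOn.divisor entireZeta (Metric.closedBall 0 r) u := by
  classical
  have han : AnalyticOnNhd ℂ entireZeta (Metric.closedBall 0 r) := fun z _ =>
    differentiable_entireZeta.analyticAt z
  set D := MeromorphicOn.divisor entireZeta (Metric.closedBall 0 r)
  have hfin : (Function.support D).Finite := D.finiteSupport (isCompact_closedBall 0 r)
  have hD0 : ∀ u, 0 ≤ D u := MeromorphicOn.AnalyticOnNhd.divisor_nonneg han
  have hfib : ∀ ρ ∈ s.image zetaZero, (((s.filter fun i => zetaZero i = ρ).card : ℕ) : ℤ) ≤ D ρ := by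
    intro ρ hρ
    obtain ⟨j, hj, rfl⟩ := Finset.mem_image.1 hρ
    have hmem : zetaZero j ∈ Metric.closedBall (0 : ℂ) r := by simpa using hs j hj
    have hval : D (zetaZero j) = analyticOrderNatAt riemannZeta (zetaZero j) := by
      rw [MeromorphicOn.AnalyticOnNhd.divisor_apply han hmem, analyticOrderAt_entireZeta (s := zetaZero j) j.1.2.2,
        analyticOrderNatAt]
      -- Both conventions send infinite order to 0.
      cases analyticOrderAt riemannZeta (zetaZero j) <;> rfl
    rw [hval, Nat.cast_le]
    rw [← Finset.card_range (analyticOrderNatAt riemannZeta (zetaZero j))]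
    refine Finset.card_le_card_of_injOn (fun i => Fin.val i.2) (fun i hi => ?_) ?_
    · rw [← (Finset.mem_filter.1 hi).2]
      exact Finset.mem_coe.2 (Finset.mem_range.2 (Fin.isLt i.2))
    · rintro ⟨a, x⟩ ha ⟨b, y⟩ hb hxy
      have hab : a = b := Subtype.ext
        ((Finset.mem_filter.1 ha).2.trans (Finset.mem_filter.1 hb).2.symm)
      subst hab
      exact congrArg _ (Fin.ext hxy)
  calc (s.card : ℤ) = ∑ ρ ∈ s.image zetaZero, (((s.filter fun i => zetaZero i = ρ).card : ℕ) : ℤ) := by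
        rw [Finset.card_eq_sum_card_image zetaZero s, Nat.cast_sum]
    _ ≤ ∑ ρ ∈ s.image zetaZero, D ρ := Finset.sum_le_sum hfib
    _ ≤ ∑ ρ ∈ s.image zetaZero ∪ hfin.toFinset, D ρ :=
        Finset.sum_le_sum_of_subset_of_nonneg Finset.subset_union_left fun u _ _ => hD0 u
    _ = ∑ᶠ u, D u := by
        rw [finsum_eq_sum_of_support_subset]
        intro u hu
        simp only [Finset.coe_union, Set.mem_union, Set.Finite.coe_toFinset]
        exact Or.inr hu

theorem norm_riemannZeta_nat_le_two {k : ℕ} (hk : 2 ≤ k) : ‖riemannZeta k‖ ≤ 2 := by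
  have h2 : ‖riemannZeta 2‖ ≤ 2 := by
    rw [riemannZeta_two, norm_div, norm_pow, Complex.norm_real, Real.norm_of_nonneg Real.pi_pos.le]
    have := Real.pi_lt_d2
    have := Real.pi_gt_three
    norm_num
    rw [div_le_iff₀ (by norm_num)]
    nlinarith
  have hs : ∀ k : ℕ, 2 ≤ k → Summable fun n : ℕ => 1 / (n : ℝ) ^ k := fun k hk =>
    Real.summable_one_div_nat_pow.2 (by omega)
  have hre : ∀ k : ℕ, 2 ≤ k → riemannZeta k = ((∑' n : ℕ, 1 / (n : ℝ) ^ k : ℝ) : ℂ) := by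
    intro k hk
    rw [zeta_nat_eq_tsum_of_gt_one (by omega)]
    push_cast
    rfl
  have hnn : ∀ k : ℕ, 0 ≤ ∑' n : ℕ, 1 / (n : ℝ) ^ k := fun k => tsum_nonneg fun n => by positivity
  have h2' := hre 2 le_rfl
  rw [Nat.cast_ofNat] at h2'
  rw [h2', Complex.norm_real, Real.norm_of_nonneg (hnn _)] at h2
  rw [hre k hk, Complex.norm_real, Real.norm_of_nonneg (hnn _)]
  refine le_trans ((hs k hk).tsum_le_tsum (fun n => ?_) (hs 2 le_rfl)) h2
  rcases Nat.eq_zero_or_pos n with rfl | hn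
  · simp [show k ≠ 0 by omega]
  · have : (1 : ℝ) ≤ n := by exact_mod_cast hn
    exact one_div_le_one_div_of_le (by positivity) (pow_le_pow_right₀ this hk)

/-- At this even integer the gamma factor is `π^(-(N+1)) N!`, and the two pole terms contribute at
most 1 each. -/
theorem norm_completedRiemannZeta₀_two_mul_nat_le (N : ℕ) :
    ‖completedRiemannZeta₀ ((2 * N + 2 : ℝ) : ℂ)‖ ≤ 2 * N.factorial + 2 := by
  set s : ℂ := ((2 * N + 2 : ℝ) : ℂ) with hs
  have hsn : s = ((2 * N + 2 : ℕ) : ℂ) := by rw [hs]; push_cast; rfl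
  have hs0 : s ≠ 0 := by rw [hsn]; exact_mod_cast Nat.succ_ne_zero (2 * N + 1)
  have hΓ0 : Complex.Gammaℝ s ≠ 0 := Complex.Gammaℝ_ne_zero_of_re_pos (by
    rw [hs, Complex.ofReal_re]; positivity)
  have h1 : completedRiemannZeta₀ s = riemannZeta s * Complex.Gammaℝ s + 1 / s + 1 / (1 - s) := by
    rw [riemannZeta_def_of_ne_zero hs0, div_mul_cancel₀ _ hΓ0, completedRiemannZeta_eq]
    ring
  have hζ : ‖riemannZeta s‖ ≤ 2 := by
    rw [hsn]; exact norm_riemannZeta_nat_le_two (by omega)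
  have hΓ : ‖Complex.Gammaℝ s‖ ≤ N.factorial := by
    have h2 : s / 2 = (N : ℂ) + 1 := by rw [hs]; push_cast; ring
    rw [Complex.Gammaℝ, norm_mul, h2, Complex.Gamma_nat_eq_factorial, Complex.norm_natCast,
      Complex.norm_cpow_eq_rpow_re_of_pos Real.pi_pos]
    refine mul_le_of_le_one_left (by positivity) (Real.rpow_le_one_of_one_le_of_nonpos ?_ ?_)
    · linarith [Real.pi_gt_three]
    · rw [neg_div, h2, Complex.neg_re, Left.neg_nonpos_iff]; simp; positivity
  have hi : ‖1 / s‖ ≤ 1 := by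
    rw [norm_div, norm_one, hs, Complex.norm_real, Real.norm_of_nonneg (by positivity)]
    exact div_le_one_of_le₀ (by linarith [(Nat.cast_nonneg N : (0 : ℝ) ≤ N)]) (by positivity)
  have hj : ‖1 / (1 - s)‖ ≤ 1 := by
    have : 1 - s = ((-(2 * N + 1) : ℝ) : ℂ) := by rw [hs]; push_cast; ring
    rw [norm_div, norm_one, this, Complex.norm_real, norm_neg, Real.norm_of_nonneg (by positivity)]
    exact div_le_one_of_le₀ (by linarith [(Nat.cast_nonneg N : (0 : ℝ) ≤ N)]) (by positivity)
  rw [h1]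
  refine (norm_add₃_le ..).trans ?_
  rw [norm_mul]
  have := mul_le_mul hζ hΓ (norm_nonneg _) zero_le_two
  linarith

theorem norm_entireZeta_le {N : ℕ} (hN : 1 ≤ N) {s : ℂ} (hs : ‖s‖ ≤ 2 * N) :
    ‖entireZeta s‖ ≤ 49 * (N : ℝ) ^ (N + 2) := by
  have hN' : (1 : ℝ) ≤ N := by exact_mod_cast hN
  have hre := abs_le.1 ((Complex.abs_re_le_norm s).trans hs)
  -- The edges are swapped by `s ↦ 1 - s`, so both values equal the one at `2N + 2`.
  have h1 := norm_completedRiemannZeta₀_le (s := s) (a := 1 - (2 * N + 2)) (b := 2 * N + 2)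
    (by linarith) (by linarith)
  rw [Complex.ofReal_sub, Complex.ofReal_one, completedRiemannZeta₀_one_sub] at h1
  have h2 := norm_completedRiemannZeta₀_two_mul_nat_le N
  have h3 : (N.factorial : ℝ) ≤ (N : ℝ) ^ N := by exact_mod_cast Nat.factorial_le_pow N
  have h4 : (1 : ℝ) ≤ (N : ℝ) ^ N := one_le_pow₀ hN'
  have h5 : ‖completedRiemannZeta₀ s‖ ≤ 8 * (N : ℝ) ^ N := by linarith
  have h6 : ‖1 - s‖ ≤ 3 * N := by
    refine (norm_sub_le _ _).trans ?_
    rw [norm_one]; linarith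
  have h7 : ‖entireZeta s‖ ≤ ‖s‖ * ‖1 - s‖ * ‖completedRiemannZeta₀ s‖ + 1 := by
    rw [← norm_mul, ← norm_mul]
    refine (norm_sub_le _ _).trans ?_
    rw [norm_one]
  have h8 : ‖s‖ * ‖1 - s‖ * ‖completedRiemannZeta₀ s‖ ≤ 2 * N * (3 * N) * (8 * (N : ℝ) ^ N) := by
    gcongr
  have h9 : (1 : ℝ) ≤ (N : ℝ) ^ (N + 2) := one_le_pow₀ hN'
  have h10 : 2 * N * (3 * N) * (8 * (N : ℝ) ^ N) = 48 * (N : ℝ) ^ (N + 2) := by ring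
  linarith

theorem card_zetaZero_le {N : ℕ} (hN : 1 ≤ N) (s : Finset ZetaZeroIndex)
    (hs : ∀ i ∈ s, ‖zetaZero i‖ ≤ N) :
    (s.card : ℝ) ≤ (Real.log 49 + (N + 2) * Real.log N) / Real.log 2 := by
  have hN' : (1 : ℝ) ≤ N := by exact_mod_cast hN
  have hN0 : (0 : ℝ) < N := by linarith
  have h1 := card_le_sum_divisor_entireZeta s hs
  have hF0 : entireZeta 0 = -1 := by simp [entireZeta]
  have hR : |(2 * N : ℝ)| = 2 * N := abs_of_pos (by positivity)
  -- Jensen on radii `N` and `2N`, normalised by `|entireZeta 0| = 1`; the ratio of radii yields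
  -- `log 2`.
  have h2 := AnalyticOnNhd.sum_divisor_le (c := 0) (r := N) (R := 2 * N)
    (M := 49 * (N : ℝ) ^ (N + 2)) (f := entireZeta) (by rwa [abs_of_pos hN0])
    (by rw [hR, abs_of_pos hN0]; linarith)
    (by nlinarith [one_le_pow₀ hN' (n := N + 2)])
    (fun z _ => differentiable_entireZeta.analyticAt z) (by rw [hF0]; norm_num)
    (fun z hz => norm_entireZeta_le hN (by rw [hR] at hz; simpa using hz.le))
  rw [abs_of_pos hN0, hF0, norm_neg, norm_one, div_one, mul_div_assoc, div_self hN0.ne', mul_one,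
    Real.log_mul (by norm_num) (by positivity), Real.log_pow] at h2
  refine le_trans (by exact_mod_cast h1) (h2.trans_eq ?_)
  push_cast
  rfl

theorem exists_card_zetaZero_le_rpow {p : ℝ} (hp : 1 < p) :
    ∃ C : ℝ, 0 ≤ C ∧ ∀ N : ℕ, 1 ≤ N → ∀ s : Finset ZetaZeroIndex,
      (∀ i ∈ s, ‖zetaZero i‖ ≤ N) → (s.card : ℝ) ≤ C * (N : ℝ) ^ p := by
  have hl2 : 0 < Real.log 2 := Real.log_pos one_lt_two
  have hl49 : 0 < Real.log 49 := Real.log_pos (by norm_num)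
  have hp' : 0 < p - 1 := by linarith
  refine ⟨(Real.log 49 + 3 / (p - 1)) / Real.log 2, by positivity, fun N hN s hs => ?_⟩
  refine (card_zetaZero_le hN s hs).trans ?_
  rw [div_mul_eq_mul_div]
  gcongr
  have hN' : (1 : ℝ) ≤ N := by exact_mod_cast hN
  have h1 := Real.log_le_rpow_div (by linarith : (0 : ℝ) ≤ N) hp'
  have h2 : (1 : ℝ) ≤ (N : ℝ) ^ p := Real.one_le_rpow hN' (by linarith)
  have h3 : (N : ℝ) ^ p = N * (N : ℝ) ^ (p - 1) := by
    rw [Real.rpow_sub (by linarith), Real.rpow_one]; field_simp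
  have h4 : (N + 2) * Real.log N ≤ (3 * N) * ((N : ℝ) ^ (p - 1) / (p - 1)) := by
    have := Real.log_nonneg hN'
    gcongr
    linarith
  have h5 : (3 * N) * ((N : ℝ) ^ (p - 1) / (p - 1)) = 3 / (p - 1) * (N : ℝ) ^ p := by
    rw [h3]; ring
  nlinarith

/-! ### Convergence of `∑ |α|^(-σ)` -/

/-- If the number of `i` with `r i ≤ N` is `O(N ^ p)`, then `∑ (r i) ^ (-σ)` converges for
`σ > p`. -/
theorem summable_rpow_neg_of_card_le {ι : Type*} {r : ι → ℝ} (hr : ∀ i, 1 ≤ r i) {p σ C : ℝ}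
    (hpσ : p < σ) (hσ : 0 < σ)
    (hC : ∀ N : ℕ, 1 ≤ N → ∀ s : Finset ι, (∀ i ∈ s, r i ≤ N) → (s.card : ℝ) ≤ C * (N : ℝ) ^ p) :
    Summable fun i => r i ^ (-σ) := by
  classical
  -- Dyadic blocks `2^k ≤ r < 2^(k+1)`: each contributes at most a constant times `2^(k(p-σ))`.
  choose k hk hk' using fun i => exists_nat_pow_near (hr i) one_lt_two
  have hgeo : Summable fun n : ℕ => C * 2 ^ p * ((2 : ℝ) ^ (p - σ)) ^ n :=
    (summable_geometric_of_lt_one (by positivity)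
      (Real.rpow_lt_one_of_one_lt_of_neg one_lt_two (by linarith))).mul_left _
  have hC0 : 0 ≤ C := by simpa using hC 1 le_rfl ∅ (by simp)
  refine summable_of_sum_le (c := ∑' n : ℕ, C * 2 ^ p * ((2 : ℝ) ^ (p - σ)) ^ n)
    (fun i => Real.rpow_nonneg (by linarith [hr i]) _) fun s => ?_
  calc ∑ i ∈ s, r i ^ (-σ) ≤ ∑ i ∈ s, ((2 : ℝ) ^ k i) ^ (-σ) := Finset.sum_le_sum fun i _ =>
        Real.rpow_le_rpow_of_nonpos (by positivity) (hk i) (by linarith)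
    _ = ∑ n ∈ s.image k, ∑ i ∈ s with k i = n, ((2 : ℝ) ^ k i) ^ (-σ) :=
        (Finset.sum_fiberwise_of_maps_to (fun i hi => Finset.mem_image_of_mem k hi) _).symm
    _ ≤ ∑ n ∈ s.image k, C * 2 ^ p * ((2 : ℝ) ^ (p - σ)) ^ n := by
        refine Finset.sum_le_sum fun n _ => ?_
        have h1 : ∑ i ∈ s with k i = n, ((2 : ℝ) ^ k i) ^ (-σ) =
            (s.filter fun i => k i = n).card * ((2 : ℝ) ^ n) ^ (-σ) := by
          rw [← nsmul_eq_mul]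
          exact Finset.sum_eq_card_nsmul fun i hi => by rw [(Finset.mem_filter.1 hi).2]
        have h2 := hC (2 ^ (n + 1)) Nat.one_le_two_pow (s.filter fun i => k i = n) (fun i hi => by
          rw [← (Finset.mem_filter.1 hi).2]; push_cast; exact (hk' i).le)
        rw [h1]
        refine (mul_le_mul_of_nonneg_right h2 (by positivity)).trans_eq ?_
        push_cast
        rw [pow_succ, Real.mul_rpow (by positivity) (by positivity), ← Real.rpow_natCast,
          ← Real.rpow_natCast, ← Real.rpow_mul (by norm_num), ← Real.rpow_mul (by norm_num),
          ← Real.rpow_mul (by norm_num)]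
        have : (p - σ) * (n : ℝ) = n * p + n * -σ := by ring
        rw [this, Real.rpow_add (by norm_num)]
        ring
    _ ≤ _ := hgeo.sum_le_tsum _ fun n _ => by positivity

theorem one_lt_re_zetaAlpha (n : ZetaZeroIndex) : 1 < (zetaAlpha n).re := by
  have h := one_lt_im_of_riemannZeta_eq_zero n.1.2.1 n.1.2.2
  have h2 : (zetaAlpha n).re = n.1.val.im := by simp [zetaAlpha, zetaZero]
  rwa [h2]

theorem abs_im_zetaAlpha_lt (n : ZetaZeroIndex) : |(zetaAlpha n).im| < 1 / 2 := by
  obtain ⟨h, h'⟩ := re_mem_Ioo_of_riemannZeta_eq_zero n.1.2.1 n.1.2.2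
  have h2 : (zetaAlpha n).im = 1 / 2 - n.1.val.re := by
    simp [zetaAlpha, zetaZero]
  rw [h2, abs_lt]
  constructor <;> linarith

theorem one_le_norm_zetaAlpha (n : ZetaZeroIndex) : 1 ≤ ‖zetaAlpha n‖ :=
  (one_lt_re_zetaAlpha n).le.trans (Complex.re_le_norm _)

theorem summable_norm_zetaAlpha_rpow_neg {σ : ℝ} (hσ : 1 < σ) :
    Summable fun n => ‖zetaAlpha n‖ ^ (-σ) := by
  obtain ⟨C, hC0, hC⟩ := exists_card_zetaZero_le_rpow (p := (1 + σ) / 2) (by linarith)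
  refine summable_rpow_neg_of_card_le (p := (1 + σ) / 2) (C := C * 2 ^ ((1 + σ) / 2))
    one_le_norm_zetaAlpha (by linarith) (by linarith) fun N hN s hs => ?_
  have hN' : (1 : ℝ) ≤ N := by exact_mod_cast hN
  -- `|ρ| ≤ 1/2 + |α| ≤ 2N`.
  have h := hC (2 * N) (by omega) s fun i hi => by
    rw [zetaZero_eq]
    refine (norm_add_le _ _).trans ?_
    rw [norm_mul, Complex.norm_I, one_mul]
    have := hs i hi
    norm_num
    linarith
  refine h.trans_eq ?_
  push_cast
  rw [Real.mul_rpow (by norm_num) (by positivity)]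
  ring

/-! ### Integration of series and the complex gamma integral -/

open MeasureTheory in
theorem integrable_of_summable_integral_norm {α ι E : Type*} [MeasurableSpace α] {μ : Measure α}
    [NormedAddCommGroup E] [Countable ι] {F : ι → α → E} {g : α → E}
    (hF : ∀ i, Integrable (F i) μ) (hsum : Summable fun i => ∫ a, ‖F i a‖ ∂μ)
    (hg : AEStronglyMeasurable g μ) (hFg : ∀ᵐ a ∂μ, g a = ∑' i, F i a) : Integrable g μ := by
  refine ⟨hg, lt_of_le_of_lt ?_ (hsum.tsum_ofReal_lt_top)⟩
  calc ∫⁻ a, ‖g a‖ₑ ∂μ ≤ ∫⁻ a, ∑' i, ‖F i a‖ₑ ∂μ := lintegral_mono_ae (hFg.mono fun a ha => by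
        rw [ha]; exact enorm_tsum_le_tsum_enorm)
    _ = ∑' i, ∫⁻ a, ‖F i a‖ₑ ∂μ := lintegral_tsum fun i => (hF i).1.enorm
    _ = ∑' i, ENNReal.ofReal (∫ a, ‖F i a‖ ∂μ) := by
        simp_rw [ofReal_integral_norm_eq_lintegral_enorm (hF _)]

namespace Complex
open MeasureTheory Set

theorem norm_cpow_mul_exp_neg_mul {a w : ℂ} {t : ℝ} (ht : 0 < t) :
    ‖(t : ℂ) ^ (a - 1) * exp (-(w * t))‖ = t ^ (a.re - 1) * Real.exp (-(w.re * t)) := by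
  rw [norm_mul, norm_cpow_eq_rpow_re_of_pos ht, norm_exp]
  simp

theorem continuousOn_cpow_mul_exp_neg_mul (a w : ℂ) :
    ContinuousOn (fun t : ℝ => (t : ℂ) ^ (a - 1) * exp (-(w * t))) (Ioi 0) := by
  intro t ht
  refine ContinuousAt.continuousWithinAt ?_
  have h := continuousAt_ofReal_cpow_const t (a - 1) (Or.inr (ne_of_gt ht))
  fun_prop

theorem integrableOn_rpow_mul_exp_neg_mul {σ c : ℝ} (hσ : 0 < σ) (hc : 0 < c) :
    IntegrableOn (fun t : ℝ => t ^ (σ - 1) * Real.exp (-(c * t))) (Ioi 0) := by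
  have := integrableOn_rpow_mul_exp_neg_mul_rpow (p := 1) (s := σ - 1) (by linarith) one_pos hc
  simpa [neg_mul] using this

theorem integrableOn_cpow_mul_exp_neg_mul {a w : ℂ} (ha : 0 < a.re) (hw : 0 < w.re) :
    IntegrableOn (fun t : ℝ => (t : ℂ) ^ (a - 1) * exp (-(w * t))) (Ioi 0) := by
  refine (integrableOn_rpow_mul_exp_neg_mul ha hw).mono'
    ((continuousOn_cpow_mul_exp_neg_mul a w).aestronglyMeasurable measurableSet_Ioi) ?_
  filter_upwards [ae_restrict_mem measurableSet_Ioi] with t ht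
  exact (norm_cpow_mul_exp_neg_mul ht).le

theorem differentiableOn_integral_cpow_mul_exp_neg_mul {a : ℂ} (ha : 0 < a.re) :
    DifferentiableOn ℂ (fun w : ℂ => ∫ t : ℝ in Ioi 0, (t : ℂ) ^ (a - 1) * exp (-(w * t)))
      {w | 0 < w.re} := by
  intro w (hw : 0 < w.re)
  -- On this half-plane the derivative in `w`, which brings down a factor `t`, is dominated by a
  -- gamma integrand of exponent `a.re + 1`.
  have hs : {z : ℂ | w.re / 2 < z.re} ∈ nhds w :=
    (isOpen_lt continuous_const continuous_re).mem_nhds (by simp; linarith)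
  have h := hasDerivAt_integral_of_dominated_loc_of_deriv_le (𝕜 := ℂ)
    (μ := volume.restrict (Ioi (0 : ℝ)))
    (F := fun (w : ℂ) (t : ℝ) => (t : ℂ) ^ (a - 1) * exp (-(w * t)))
    (F' := fun (w : ℂ) (t : ℝ) => (t : ℂ) ^ (a - 1) * (exp (-(w * t)) * (-t)))
    (bound := fun t => t ^ (a.re + 1 - 1) * Real.exp (-(w.re / 2 * t))) hs
    (.of_forall fun z =>
      (continuousOn_cpow_mul_exp_neg_mul a z).aestronglyMeasurable measurableSet_Ioi)
    (integrableOn_cpow_mul_exp_neg_mul ha hw) ?_ ?_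
    (integrableOn_rpow_mul_exp_neg_mul (by linarith) (by linarith)) ?_
  · exact h.2.differentiableAt.differentiableWithinAt
  · refine ContinuousOn.aestronglyMeasurable ?_ measurableSet_Ioi
    simp_rw [← mul_assoc]
    exact (continuousOn_cpow_mul_exp_neg_mul a w).mul (by fun_prop)
  · filter_upwards [ae_restrict_mem measurableSet_Ioi] with t (ht : 0 < t) z (hz : w.re / 2 < z.re)
    rw [← mul_assoc, norm_mul, norm_cpow_mul_exp_neg_mul ht, norm_neg, norm_real,
      Real.norm_of_nonneg ht.le, show a.re + 1 - 1 = (a.re - 1) + 1 by ring, Real.rpow_add ht,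
      Real.rpow_one, mul_right_comm]
    gcongr
  · refine .of_forall fun t z _ => ?_
    have h1 : HasDerivAt (fun z : ℂ => -(z * t)) (-t) z := by
      simpa using ((hasDerivAt_id z).mul_const (t : ℂ)).fun_neg
    exact h1.cexp.const_mul _

/-- The integral `∫ t ^ (a - 1) * exp (-(w * t))` for complex `w` in the right half-plane. -/
theorem integral_cpow_mul_exp_neg_mul_Ioi_of_re_pos {a w : ℂ} (ha : 0 < a.re) (hw : 0 < w.re) :
    ∫ t : ℝ in Ioi 0, (t : ℂ) ^ (a - 1) * exp (-(w * t)) = (1 / w) ^ a * Gamma a := by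
  have hU : IsOpen {w : ℂ | 0 < w.re} := isOpen_lt continuous_const continuous_re
  have hrhs : DifferentiableOn ℂ (fun w : ℂ => (1 / w) ^ a * Gamma a) {w | 0 < w.re} := by
    intro z (hz : 0 < z.re)
    have hz0 : z ≠ 0 := by rintro rfl; simp at hz
    have h1 : DifferentiableAt ℂ (fun w : ℂ => 1 / w) z :=
      (differentiableAt_const _).div differentiableAt_id hz0
    have h2 : 1 / z ∈ slitPlane := by
      left
      rw [one_div, inv_re]
      exact div_pos hz (normSq_pos.2 hz0)
    exact ((h1.cpow (differentiableAt_const a) h2).mul_const _).differentiableWithinAt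
  -- Identity theorem: the real case gives equality at the points `1 + 1/(n+1)`, which accumulate at
  -- 1.
  refine ((differentiableOn_integral_cpow_mul_exp_neg_mul ha).analyticOnNhd
    hU).eqOn_of_preconnected_of_frequently_eq (hrhs.analyticOnNhd hU)
    (convex_halfSpace_re_gt 0).isPreconnected (z₀ := 1) (by simp) ?_ hw
  have htend : Filter.Tendsto (fun n : ℕ => ((1 + 1 / ((n : ℝ) + 1) : ℝ) : ℂ)) Filter.atTop
      (nhdsWithin 1 {1}ᶜ) := by
    refine tendsto_nhdsWithin_iff.2 ⟨?_, .of_forall fun n => ?_⟩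
    · have h1 := (tendsto_one_div_add_atTop_nhds_zero_nat (𝕜 := ℝ)).const_add 1
      have h2 := (continuous_ofReal.tendsto _).comp h1
      simpa [Function.comp_def] using h2
    · have : (0 : ℝ) < 1 / ((n : ℝ) + 1) := by positivity
      simp only [mem_compl_iff, mem_singleton_iff]
      rw [← ofReal_one, ofReal_inj]
      linarith
  refine htend.frequently (Filter.Frequently.of_forall fun n => ?_)
  exact integral_cpow_mul_exp_neg_mul_Ioi ha (by positivity)

end Complex

/-! ### The theta series and the secondary zeta series -/

theorem re_zetaAlpha_sq (n : ZetaZeroIndex) :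
    ((zetaAlpha n) ^ 2).re = (zetaAlpha n).re ^ 2 - (zetaAlpha n).im ^ 2 := by
  rw [sq, Complex.mul_re]; ring

theorem norm_zetaAlpha_sq (n : ZetaZeroIndex) :
    ‖zetaAlpha n‖ ^ 2 = (zetaAlpha n).re ^ 2 + (zetaAlpha n).im ^ 2 := by
  rw [Complex.sq_norm, Complex.normSq_apply]; ring

theorem im_zetaAlpha_sq_lt (n : ZetaZeroIndex) : (zetaAlpha n).im ^ 2 < 1 / 4 := by
  have := abs_im_zetaAlpha_lt n
  rw [← sq_abs]
  nlinarith [abs_nonneg (zetaAlpha n).im]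

theorem le_re_zetaAlpha_sq (n : ZetaZeroIndex) :
    (1 / 4) * ‖zetaAlpha n‖ ^ 2 ≤ ((zetaAlpha n) ^ 2).re := by
  rw [re_zetaAlpha_sq, norm_zetaAlpha_sq]
  have := one_lt_re_zetaAlpha n
  have := im_zetaAlpha_sq_lt n
  nlinarith

theorem re_zetaAlpha_sq_pos (n : ZetaZeroIndex) : 0 < ((zetaAlpha n) ^ 2).re := by
  have := le_re_zetaAlpha_sq n
  have := one_le_norm_zetaAlpha n
  nlinarith

theorem zetaAlpha_ne_zero (n : ZetaZeroIndex) : zetaAlpha n ≠ 0 := by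
  have := one_le_norm_zetaAlpha n
  rw [← norm_pos_iff]
  linarith

/-- A locally uniform majorant for the Weierstrass test. With `α = a + ib`, the cross term `2ab Im
z` is at most `aY`, absorbed by completing the square; then `exp(-u) ≤ 1/(1+u)` and `|α|² ≤ 5a²/4`.
-/
theorem norm_exp_neg_zetaAlpha_sq_mul_le {x₀ Y : ℝ} (hx₀ : 0 < x₀) {z : ℂ} (hx : x₀ ≤ z.re)
    (hy : |z.im| ≤ Y) (n : ZetaZeroIndex) :
    ‖Complex.exp (-(zetaAlpha n) ^ 2 * z)‖ ≤
      Real.exp (Y ^ 2 / x₀) * (5 / (2 * x₀)) * ‖zetaAlpha n‖ ^ (-2 : ℝ) := by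
  have ha := one_lt_re_zetaAlpha n
  have hb := im_zetaAlpha_sq_lt n
  have hb' := abs_im_zetaAlpha_lt n
  have hn := norm_zetaAlpha_sq n
  have hnpos : 0 < ‖zetaAlpha n‖ := norm_pos_iff.2 (zetaAlpha_ne_zero n)
  set a := (zetaAlpha n).re with hadef
  set b := (zetaAlpha n).im with hbdef
  have hre : (-(zetaAlpha n) ^ 2 * z).re = -((a ^ 2 - b ^ 2) * z.re - 2 * a * b * z.im) := by
    rw [neg_mul, Complex.neg_re, Complex.mul_re, re_zetaAlpha_sq, sq (zetaAlpha n), Complex.mul_im]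
    ring
  have hY : 0 ≤ Y := (abs_nonneg _).trans hy
  have h1 : b * z.im ≤ 1 / 2 * Y := by
    refine (le_abs_self _).trans ?_
    rw [abs_mul]
    exact mul_le_mul hb'.le hy (abs_nonneg _) (by norm_num)
  have h2 : 3 / 4 * a ^ 2 * x₀ ≤ (a ^ 2 - b ^ 2) * z.re :=
    mul_le_mul (by nlinarith) hx hx₀.le (by nlinarith)
  have h3 : a * Y ≤ a ^ 2 * x₀ / 4 + Y ^ 2 / x₀ := by
    have h4 : a ^ 2 * x₀ / 4 + Y ^ 2 / x₀ - a * Y = (a * x₀ / 2 - Y) ^ 2 / x₀ := by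
      field_simp; ring
    have h5 : 0 ≤ (a * x₀ / 2 - Y) ^ 2 / x₀ := by positivity
    linarith
  have h4 : (-(zetaAlpha n) ^ 2 * z).re ≤ Y ^ 2 / x₀ + -(a ^ 2 * x₀ / 2) := by
    rw [hre]
    have : a * (b * z.im) ≤ a * (1 / 2 * Y) := mul_le_mul_of_nonneg_left h1 (by linarith)
    nlinarith
  have h5 : Real.exp (-(a ^ 2 * x₀ / 2)) ≤ 5 / (2 * x₀) * ‖zetaAlpha n‖ ^ (-2 : ℝ) := by
    rw [Real.rpow_neg hnpos.le, Real.rpow_two, Real.exp_neg, ← div_eq_mul_inv, div_div,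
      inv_le_comm₀ (Real.exp_pos _) (by positivity), inv_div, hn]
    have h6 := Real.add_one_le_exp (a ^ 2 * x₀ / 2)
    have h7 : 2 * x₀ * (a ^ 2 + b ^ 2) / 5 ≤ a ^ 2 * x₀ / 2 := by
      have : x₀ * (a ^ 2 + b ^ 2) ≤ x₀ * (5 / 4 * a ^ 2) :=
        mul_le_mul_of_nonneg_left (by nlinarith) hx₀.le
      linarith
    linarith
  rw [Complex.norm_exp]
  refine (Real.exp_le_exp.2 h4).trans ?_
  rw [Real.exp_add, mul_assoc]
  gcongr

theorem summable_exp_neg_zetaAlpha_sq_mul {z : ℂ} (hz : 0 < z.re) :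
    Summable fun n => Complex.exp (-(zetaAlpha n) ^ 2 * z) :=
  .of_norm_bounded ((summable_norm_zetaAlpha_rpow_neg one_lt_two).mul_left _)
    fun n => norm_exp_neg_zetaAlpha_sq_mul_le hz le_rfl le_rfl n

theorem differentiableOn_zeroTheta : DifferentiableOn ℂ zeroTheta {z : ℂ | 0 < z.re} := by
  intro z (hz : 0 < z.re)
  set U : Set ℂ := {w | z.re / 2 < w.re} ∩ {w | |w.im| < |z.im| + 1} with hUdef
  have hU : IsOpen U := (isOpen_lt continuous_const Complex.continuous_re).inter
    (isOpen_lt Complex.continuous_im.abs continuous_const)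
  have hzU : z ∈ U := ⟨by simp; linarith, by simp⟩
  refine DifferentiableAt.differentiableWithinAt (DifferentiableOn.differentiableAt ?_
    (hU.mem_nhds hzU))
  exact Complex.differentiableOn_tsum_of_summable_norm
    ((summable_norm_zetaAlpha_rpow_neg one_lt_two).mul_left _)
    (fun n => by fun_prop) hU
    (fun n w hw => norm_exp_neg_zetaAlpha_sq_mul_le (by linarith) hw.1.le hw.2.le n)

theorem summable_one_div_zetaAlpha_cpow {s : ℂ} (hs : 1 < s.re) :
    Summable fun n => 1 / zetaAlpha n ^ s := by
  refine .of_norm_bounded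
    ((summable_norm_zetaAlpha_rpow_neg hs).mul_left (Real.exp (Real.pi * |s.im|))) fun n => ?_
  rw [norm_div, norm_one, Complex.norm_cpow_of_ne_zero (zetaAlpha_ne_zero n), one_div_div,
    Real.rpow_neg (norm_nonneg _), div_eq_mul_inv]
  refine mul_le_mul_of_nonneg_right (Real.exp_le_exp.2 ((le_abs_self _).trans ?_)) (by positivity)
  rw [abs_mul]
  exact mul_le_mul_of_nonneg_right (Complex.abs_arg_le_pi _) (abs_nonneg _)

/-- Since `|arg α| < π/2`, doubling the argument stays inside `(-π, π)` and the principal branches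
agree. -/
theorem one_div_zetaAlpha_sq_cpow (s : ℂ) (n : ZetaZeroIndex) :
    (1 / zetaAlpha n ^ 2) ^ (s / 2) = 1 / zetaAlpha n ^ s := by
  have harg : (zetaAlpha n ^ 2).arg ≠ Real.pi :=
    (Complex.mem_slitPlane_iff_arg.1 (Or.inl (re_zetaAlpha_sq_pos n))).1
  have h := abs_lt.1 (Complex.abs_arg_lt_pi_div_two_iff.2
    (Or.inl (zero_lt_one.trans (one_lt_re_zetaAlpha n))))
  have h2 := Complex.cpow_nat_mul' (x := zetaAlpha n) (n := 2) (by push_cast; linarith)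
    (by push_cast; linarith) (s / 2)
  rw [one_div, Complex.inv_cpow _ _ harg, ← h2, one_div]
  congr 2
  push_cast
  ring

/-! ### Exchange of sum and integral -/

open MeasureTheory in
theorem summable_integral_norm_exp_neg_zetaAlpha_sq_mul {s : ℂ} (hs : 1 < s.re) :
    Summable fun n => ∫ x in Set.Ioi (0 : ℝ),
      ‖(x : ℂ) ^ (s / 2 - 1) * Complex.exp (-(zetaAlpha n ^ 2 * x))‖ := by
  have hs2 : (s / 2).re = s.re / 2 := by simp
  have hval : ∀ n, ∫ x in Set.Ioi (0 : ℝ),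
      ‖(x : ℂ) ^ (s / 2 - 1) * Complex.exp (-(zetaAlpha n ^ 2 * x))‖ =
      (1 / (zetaAlpha n ^ 2).re) ^ (s.re / 2) * Real.Gamma (s.re / 2) := by
    intro n
    rw [← Real.integral_rpow_mul_exp_neg_mul_Ioi (by linarith) (re_zetaAlpha_sq_pos n)]
    refine setIntegral_congr_fun measurableSet_Ioi fun x hx => ?_
    rw [Complex.norm_cpow_mul_exp_neg_mul hx, hs2]
  simp_rw [hval]
  refine Summable.mul_right _ (.of_nonneg_of_le (fun n => ?_) (fun n => ?_)
    ((summable_norm_zetaAlpha_rpow_neg hs).mul_left (4 ^ (s.re / 2))))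
  · have := re_zetaAlpha_sq_pos n
    positivity
  · have h1 := le_re_zetaAlpha_sq n
    have h2 := re_zetaAlpha_sq_pos n
    have h3 : 0 < ‖zetaAlpha n‖ := norm_pos_iff.2 (zetaAlpha_ne_zero n)
    have h4 : 1 / (zetaAlpha n ^ 2).re ≤ 4 * ‖zetaAlpha n‖ ^ (-2 : ℝ) := by
      rw [Real.rpow_neg h3.le, Real.rpow_two, ← div_eq_mul_inv, div_le_div_iff₀ h2 (by positivity)]
      linarith
    refine (Real.rpow_le_rpow (by positivity) h4 (by linarith)).trans_eq ?_
    rw [Real.mul_rpow (by norm_num) (by positivity), ← Real.rpow_mul h3.le]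
    congr 2
    ring

/-- A summable family has countable support, and this one has no zero term. -/
theorem countable_zetaZeroIndex : Countable ZetaZeroIndex := by
  have h := (summable_norm_zetaAlpha_rpow_neg one_lt_two).countable_support
  rw [Set.countable_iff_exists_injOn] at h
  obtain ⟨f, hf⟩ := h
  refine ⟨f, fun a b hab => hf ?_ ?_ hab⟩ <;>
    exact (Real.rpow_pos_of_pos (norm_pos_iff.2 (zetaAlpha_ne_zero _)) _).ne'

theorem zeroTheta_mul_cpow (s : ℂ) (x : ℝ) :
    zeroTheta x * (x : ℂ) ^ (s / 2 - 1) =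
      ∑' n, (x : ℂ) ^ (s / 2 - 1) * Complex.exp (-(zetaAlpha n ^ 2 * x)) := by
  rw [zeroTheta, mul_comm, tsum_mul_left]
  simp_rw [neg_mul]

open MeasureTheory in
theorem integrableOn_zeroTheta_mul_cpow {s : ℂ} (hs : 1 < s.re) :
    IntegrableOn (fun x : ℝ => zeroTheta x * (x : ℂ) ^ (s / 2 - 1)) (Set.Ioi 0) := by
  have := countable_zetaZeroIndex
  refine integrable_of_summable_integral_norm
    (fun n => Complex.integrableOn_cpow_mul_exp_neg_mul (by simp; linarith)
      (re_zetaAlpha_sq_pos n))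
    (summable_integral_norm_exp_neg_zetaAlpha_sq_mul hs) ?_
    (.of_forall fun x => zeroTheta_mul_cpow s x)
  refine ContinuousOn.aestronglyMeasurable ?_ measurableSet_Ioi
  refine ContinuousOn.mul (differentiableOn_zeroTheta.continuousOn.comp
    Complex.continuous_ofReal.continuousOn fun x hx => by simpa using hx) fun x hx => ?_
  exact (Complex.continuousAt_ofReal_cpow_const x _ (Or.inr (ne_of_gt hx))).continuousWithinAt

open MeasureTheory in
theorem Gamma_mul_secondaryZeta {s : ℂ} (hs : 1 < s.re) :
    Complex.Gamma (s / 2) * secondaryZeta s =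
      ∫ x in Set.Ioi (0 : ℝ), zeroTheta (x : ℂ) * (x : ℂ) ^ (s / 2 - 1) := by
  have := countable_zetaZeroIndex
  have hs2 : 0 < (s / 2).re := by simp; linarith
  simp_rw [zeroTheta_mul_cpow]
  rw [← integral_tsum_of_summable_integral_norm
    (fun n => Complex.integrableOn_cpow_mul_exp_neg_mul hs2 (re_zetaAlpha_sq_pos n))
    (summable_integral_norm_exp_neg_zetaAlpha_sq_mul hs), secondaryZeta, ← tsum_mul_left]
  refine tsum_congr fun n => ?_
  rw [Complex.integral_cpow_mul_exp_neg_mul_Ioi_of_re_pos hs2 (re_zetaAlpha_sq_pos n),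
    one_div_zetaAlpha_sq_cpow, mul_comm]

theorem mainTheorem6 :
    ((∀ z : ℂ, 0 < z.re →
        Summable fun n : ZetaZeroIndex => Complex.exp (-(zetaAlpha n) ^ 2 * z)) ∧
      DifferentiableOn ℂ zeroTheta {z : ℂ | 0 < z.re}) ∧
    ∀ s : ℂ, 1 < s.re →
      (Summable fun n : ZetaZeroIndex => 1 / zetaAlpha n ^ s) ∧
      MeasureTheory.IntegrableOn
        (fun x : ℝ => zeroTheta (x : ℂ) * (x : ℂ) ^ (s / 2 - 1)) (Set.Ioi 0) ∧
      Complex.Gamma (s / 2) * secondaryZeta s =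
        ∫ x in Set.Ioi (0 : ℝ), zeroTheta (x : ℂ) * (x : ℂ) ^ (s / 2 - 1) :=
  ⟨⟨fun _ hz => summable_exp_neg_zetaAlpha_sq_mul hz, differentiableOn_zeroTheta⟩, fun _ hs =>
    ⟨summable_one_div_zetaAlpha_cpow hs, integrableOn_zeroTheta_mul_cpow hs,
      Gamma_mul_secondaryZeta hs⟩⟩
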